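/- Let $\Phi$ be a unital commutative ring containing $\frac12$, and let $L=L_1\oplus L_0\oplus L_{-1}$ be a Jordan 3-graded Lie algebra over $\Phi$ with associated Jordan pair $V=(V^+,V^-)=(L_1,L_{-1})$. That is, $L$ is a Lie algebra over $\Phi$ with $[L_i,L_j]\subseteq L_{i+j}$ (where $L_k=0$ for $k\notin\{0,\pm1\}$), $[L_1,L_{-1}]=L_0$, and $(L_1,L_{-1})$ is a (quadratic) Jordan pair whose triple products $\{x,y,z\}=Q_{x+z}y-Q_xy-Q_zy$ are given by $\{x,y,z\}=[[x,y],z]$ for $x,z\in L_\sigma$, $y\in L_{-\sigma}$, $\sigma=\pm1$. A Lie algebra $M$ is called nondegenerate if $z\in M$ and $(\operatorname{ad} z)^2=0$ imply $z=0$; the Kostrikin radical $K(L)$ is the smallest ideal of $L$ whose quotient is a nondegenerate Lie algebra. A Jordan pair is called nondegenerate if $Q_x=0$ implies $x=0$ (for $x$ in either component); the McCrimmon radical $Mc(V)=(Mc(V)^+,Mc(V)^-)$ is the smallest ideal of $V$ whose quotient is a nondegenerate Jordan pair. Let $\mathcal I(Mc(V))$ denote the ideal of $L$ generated by $Mc(V)^+\cup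 Mc(V)^-$. Then $$K(L)=\widetilde{\mathcal I(Mc(V))}:=\{x\in L\mid [x,L]\subseteq \mathcal I(Mc(V))\},$$ that is, $K(L)$ is the preimage, under the canonical projection $L\to L/\mathcal I(Mc(V))$, of the center of $L/\mathcal I(Mc(V))$. -/

import Mathlib

/-! ### Jordan pairs -/

section JordanPairs

variable {Φ V W : Type*} [CommRing Φ] [AddCommGroup V] [Module Φ V] [AddCommGroup W] [Module Φ W]

/-- The triple product `{x, y, z} = Q_{x + z} y - Q_x y - Q_z y` obtained by linearizing a
quadratic product `Q_x y`. -/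
def jordanTriple (Q : QuadraticMap Φ V (W →ₗ[Φ] V)) (x : V) (y : W) (z : V) : V :=
  Q (x + z) y - Q x y - Q z y

/-- The identities of a (quadratic) Jordan pair, for one of the two signs. The defining
identities are required to hold in all scalar extensions, that is, together with all their
linearizations. The identities `jp1`, `jp2`, `jp3` are the three defining ones.
All of them are linear in `z`, `jp1` is linear in `y` and `jp2`, `jp3` are of degree two in `y`;
`jp2` is of degree two in `x`, so that its linearizations follow by polarization. `jp1` has degree
three in `x` and `jp3` has degree four in `x`; the identities `jp1_lin` and `jp3_lin` are their
partial linearizations (the part which is linear in `u`, after replacing `x` by `x + u`), and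
the remaining linearizations follow from these by polarization. -/
structure JordanPairIdentities (Q : QuadraticMap Φ V (W →ₗ[Φ] V))
    (Q' : QuadraticMap Φ W (V →ₗ[Φ] W)) : Prop where
  /-- `D(x, y) Q(x) = Q(x) D(y, x)` -/
  jp1 : ∀ (x : V) (y z : W),
    jordanTriple Q x y (Q x z) = Q x (jordanTriple Q' y x z)
  jp1_lin : ∀ (x u : V) (y z : W),
    jordanTriple Q u y (Q x z) + jordanTriple Q x y (jordanTriple Q x z u) =
      jordanTriple Q x (jordanTriple Q' y x z) u + Q x (jordanTriple Q' y u z)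
  /-- `D(Q(x) y, y) = D(x, Q(y) x)` -/
  jp2 : ∀ (x z : V) (y : W),
    jordanTriple Q (Q x y) y z = jordanTriple Q x (Q' y x) z
  /-- `Q(Q(x) y) = Q(x) Q(y) Q(x)` -/
  jp3 : ∀ (x : V) (y z : W),
    Q (Q x y) z = Q x (Q' y (Q x z))
  jp3_lin : ∀ (x u : V) (y z : W),
    jordanTriple Q (Q x y) z (jordanTriple Q x y u) =
      jordanTriple Q x (Q' y (Q x z)) u + Q x (Q' y (jordanTriple Q x z u))

end JordanPairs

/-- A Jordan pair `(V⁺, V⁻)` over the commutative ring `Φ`, where `Vp = V⁺` and `Vm = V⁻`. -/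
structure JordanPair (Φ Vp Vm : Type*) [CommRing Φ] [AddCommGroup Vp] [Module Φ Vp]
    [AddCommGroup Vm] [Module Φ Vm] where
  /-- the product `Q_x y` for `x ∈ V⁺`, `y ∈ V⁻` -/
  Qp : QuadraticMap Φ Vp (Vm →ₗ[Φ] Vp)
  /-- the product `Q_x y` for `x ∈ V⁻`, `y ∈ V⁺` -/
  Qm : QuadraticMap Φ Vm (Vp →ₗ[Φ] Vm)
  identities_p : JordanPairIdentities Qp Qm
  identities_m : JordanPairIdentities Qm Qp

/-! ### Quotients of quadratic products -/

section Quotients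

variable {Φ V W : Type*} [CommRing Φ] [AddCommGroup V] [Module Φ V] [AddCommGroup W] [Module Φ W]

/-- The conditions on `(U⁺, U⁻)` to be an ideal of a Jordan pair, for one of the two signs:
`Q(U⁺) V⁻ ⊆ U⁺`, `Q(V⁺) U⁻ ⊆ U⁺`, `{V⁺, V⁻, U⁺} ⊆ U⁺`. -/
structure JordanIdealConditions (Q : QuadraticMap Φ V (W →ₗ[Φ] V))
    (U : Submodule Φ V) (U' : Submodule Φ W) : Prop where
  inner_mem : ∀ u ∈ U, ∀ y : W, Q u y ∈ U
  outer_mem : ∀ (x : V), ∀ w ∈ U', Q x w ∈ U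
  triple_mem : ∀ (x : V) (y : W), ∀ u ∈ U, jordanTriple Q x y u ∈ U

/-- The product `Q_{x + U} (y + U') = Q_x y + U` induced on the quotients. -/
def quotientQ (Q : QuadraticMap Φ V (W →ₗ[Φ] V)) (U : Submodule Φ V) (U' : Submodule Φ W)
    (h : JordanIdealConditions Q U U') :
    QuadraticMap Φ (V ⧸ U) ((W ⧸ U') →ₗ[Φ] (V ⧸ U)) :=
  QuadraticMap.ofPolar
    (fun a => Quotient.liftOn' a
      (fun x => U'.mapQ U (Q x) (fun w hw => h.outer_mem x w hw))
      (by
        intro x x' hx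
        have hx' : x - x' ∈ U := (Submodule.quotientRel_def U).1 hx
        ext y
        simp only [LinearMap.comp_apply, Submodule.mkQ_apply, Submodule.mapQ_apply]
        rw [Submodule.Quotient.eq]
        have h1 := h.triple_mem x' y _ hx'
        have h2 := h.inner_mem _ hx' y
        have h3 := U.add_mem h1 h2
        rw [jordanTriple, add_sub_cancel] at h3
        simpa using h3))
    (by
      intro c a
      induction a using Submodule.Quotient.induction_on with | _ x
      rw [← Submodule.Quotient.mk_smul]
      ext y
      change (Submodule.Quotient.mk (Q (c • x) y) : V ⧸ U) = (c * c) • Submodule.Quotient.mk (Q x y)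
      rw [QuadraticMap.map_smul]; rfl)
    (by
      intro a a' b
      induction a using Submodule.Quotient.induction_on with | _ x
      induction a' using Submodule.Quotient.induction_on with | _ x'
      induction b using Submodule.Quotient.induction_on with | _ z
      ext y
      have := congrArg (fun f : W →ₗ[Φ] V => (Submodule.Quotient.mk (p := U) (f y)))
        (QuadraticMap.polar_add_left Q x x' z)
      exact this)
    (by
      intro c a b
      induction a using Submodule.Quotient.induction_on with | _ x
      induction b using Submodule.Quotient.induction_on with | _ z
      ext y
      have := congrArg (fun f : W →ₗ[Φ] V => (Submodule.Quotient.mk (p := U) (f y)))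
        (QuadraticMap.polar_smul_left Q c x z)
      exact this)

theorem quotientQ_mk (Q : QuadraticMap Φ V (W →ₗ[Φ] V)) (U : Submodule Φ V) (U' : Submodule Φ W)
    (h : JordanIdealConditions Q U U') (x : V) (y : W) :
    quotientQ Q U U' h (Submodule.Quotient.mk x) (Submodule.Quotient.mk y) =
      Submodule.Quotient.mk (Q x y) := rfl

theorem jordanTriple_quotientQ_mk (Q : QuadraticMap Φ V (W →ₗ[Φ] V)) (U : Submodule Φ V)
    (U' : Submodule Φ W) (h : JordanIdealConditions Q U U') (x z : V) (y : W) :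
    jordanTriple (quotientQ Q U U' h) (Submodule.Quotient.mk x) (Submodule.Quotient.mk y)
      (Submodule.Quotient.mk z) = Submodule.Quotient.mk (jordanTriple Q x y z) := rfl

theorem JordanPairIdentities.quotient {Q : QuadraticMap Φ V (W →ₗ[Φ] V)}
    {Q' : QuadraticMap Φ W (V →ₗ[Φ] W)} (hQ : JordanPairIdentities Q Q')
    (U : Submodule Φ V) (U' : Submodule Φ W)
    (h : JordanIdealConditions Q U U') (h' : JordanIdealConditions Q' U' U) :
    JordanPairIdentities (quotientQ Q U U' h) (quotientQ Q' U' U h') where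
  jp1 x y z := by
    induction x using Submodule.Quotient.induction_on with | _ x
    induction y using Submodule.Quotient.induction_on with | _ y
    induction z using Submodule.Quotient.induction_on with | _ z
    exact congrArg Submodule.Quotient.mk (hQ.jp1 x y z)
  jp1_lin x u y z := by
    induction x using Submodule.Quotient.induction_on with | _ x
    induction u using Submodule.Quotient.induction_on with | _ u
    induction y using Submodule.Quotient.induction_on with | _ y
    induction z using Submodule.Quotient.induction_on with | _ z
    exact congrArg Submodule.Quotient.mk (hQ.jp1_lin x u y z)
  jp2 x z y := by
    induction x using Submodule.Quotient.induction_on with | _ x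
    induction y using Submodule.Quotient.induction_on with | _ y
    induction z using Submodule.Quotient.induction_on with | _ z
    exact congrArg Submodule.Quotient.mk (hQ.jp2 x z y)
  jp3 x y z := by
    induction x using Submodule.Quotient.induction_on with | _ x
    induction y using Submodule.Quotient.induction_on with | _ y
    induction z using Submodule.Quotient.induction_on with | _ z
    exact congrArg Submodule.Quotient.mk (hQ.jp3 x y z)
  jp3_lin x u y z := by
    induction x using Submodule.Quotient.induction_on with | _ x
    induction u using Submodule.Quotient.induction_on with | _ u
    induction y using Submodule.Quotient.induction_on with | _ y
    induction z using Submodule.Quotient.induction_on with | _ z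
    exact congrArg Submodule.Quotient.mk (hQ.jp3_lin x u y z)

end Quotients

/-! ### Ideals, nondegeneracy and the McCrimmon radical of a Jordan pair -/

namespace JordanPair

variable {Φ Vp Vm : Type*} [CommRing Φ] [AddCommGroup Vp] [Module Φ Vp]
  [AddCommGroup Vm] [Module Φ Vm]

/-- `(Up, Um)` is an ideal of the Jordan pair `V`. -/
structure IsIdeal (V : JordanPair Φ Vp Vm) (Up : Submodule Φ Vp) (Um : Submodule Φ Vm) :
    Prop where
  cond_p : JordanIdealConditions V.Qp Up Um
  cond_m : JordanIdealConditions V.Qm Um Up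

/-- The quotient Jordan pair `V / U`. -/
def quotient (V : JordanPair Φ Vp Vm) (Up : Submodule Φ Vp) (Um : Submodule Φ Vm)
    (h : V.IsIdeal Up Um) : JordanPair Φ (Vp ⧸ Up) (Vm ⧸ Um) where
  Qp := quotientQ V.Qp Up Um h.cond_p
  Qm := quotientQ V.Qm Um Up h.cond_m
  identities_p := V.identities_p.quotient Up Um h.cond_p h.cond_m
  identities_m := V.identities_m.quotient Um Up h.cond_m h.cond_p

/-- A Jordan pair is nondegenerate if it has no nonzero absolute zero divisors, that is,
`Q_x = 0` implies `x = 0`. -/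
structure IsNondegenerate (V : JordanPair Φ Vp Vm) : Prop where
  eq_zero_p : ∀ x : Vp, V.Qp x = 0 → x = 0
  eq_zero_m : ∀ x : Vm, V.Qm x = 0 → x = 0

/-- The pairs of submodules that are ideals of `V` with nondegenerate quotient. -/
def nondegenerateIdeals (V : JordanPair Φ Vp Vm) : Set (Submodule Φ Vp × Submodule Φ Vm) :=
  {U | ∃ h : V.IsIdeal U.1 U.2, (V.quotient U.1 U.2 h).IsNondegenerate}

/-- The McCrimmon radical `Mc(V) = (Mc(V)⁺, Mc(V)⁻)`: the smallest ideal with nondegenerate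
quotient (see `JordanPair.isLeast_mcCrimmonRadical`). -/
def mcCrimmonRadical (V : JordanPair Φ Vp Vm) : Submodule Φ Vp × Submodule Φ Vm :=
  sInf V.nondegenerateIdeals

theorem mem_nondegenerateIdeals_iff (V : JordanPair Φ Vp Vm)
    (U : Submodule Φ Vp × Submodule Φ Vm) :
    U ∈ V.nondegenerateIdeals ↔ V.IsIdeal U.1 U.2 ∧
      (∀ x : Vp, (∀ y, V.Qp x y ∈ U.1) → x ∈ U.1) ∧
      (∀ x : Vm, (∀ y, V.Qm x y ∈ U.2) → x ∈ U.2) := by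
  constructor
  · rintro ⟨h, hn⟩
    refine ⟨h, fun x hx => ?_, fun x hx => ?_⟩
    · refine (Submodule.Quotient.mk_eq_zero U.1).1 (hn.eq_zero_p _ ?_)
      ext y
      exact (Submodule.Quotient.mk_eq_zero U.1).2 (hx y)
    · refine (Submodule.Quotient.mk_eq_zero U.2).1 (hn.eq_zero_m _ ?_)
      ext y
      exact (Submodule.Quotient.mk_eq_zero U.2).2 (hx y)
  · rintro ⟨h, hp, hm⟩
    refine ⟨h, ⟨fun x hx => ?_, fun x hx => ?_⟩⟩
    · induction x using Submodule.Quotient.induction_on with | _ x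
      refine (Submodule.Quotient.mk_eq_zero U.1).2 (hp x fun y => ?_)
      exact (Submodule.Quotient.mk_eq_zero U.1).1
        (LinearMap.congr_fun hx (Submodule.Quotient.mk y))
    · induction x using Submodule.Quotient.induction_on with | _ x
      refine (Submodule.Quotient.mk_eq_zero U.2).2 (hm x fun y => ?_)
      exact (Submodule.Quotient.mk_eq_zero U.2).1
        (LinearMap.congr_fun hx (Submodule.Quotient.mk y))

theorem mem_mcCrimmonRadical_fst (V : JordanPair Φ Vp Vm) (x : Vp) :
    x ∈ V.mcCrimmonRadical.1 ↔ ∀ U ∈ V.nondegenerateIdeals, x ∈ U.1 := by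
  simp [mcCrimmonRadical, Prod.fst_sInf, Submodule.mem_sInf]

theorem mem_mcCrimmonRadical_snd (V : JordanPair Φ Vp Vm) (x : Vm) :
    x ∈ V.mcCrimmonRadical.2 ↔ ∀ U ∈ V.nondegenerateIdeals, x ∈ U.2 := by
  simp only [mcCrimmonRadical, Prod.snd_sInf, Submodule.mem_sInf, Set.mem_image]
  exact ⟨fun h U hU => h _ ⟨U, hU, rfl⟩, by rintro h _ ⟨U, hU, rfl⟩; exact h U hU⟩

theorem isLeast_mcCrimmonRadical (V : JordanPair Φ Vp Vm) :
    IsLeast V.nondegenerateIdeals V.mcCrimmonRadical := by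
  refine ⟨?_, fun U hU => sInf_le hU⟩
  rw [mem_nondegenerateIdeals_iff]
  refine ⟨⟨⟨?_, ?_, ?_⟩, ⟨?_, ?_, ?_⟩⟩, ?_, ?_⟩
  · intro u hu y
    rw [mem_mcCrimmonRadical_fst] at *
    exact fun U hU => ((mem_nondegenerateIdeals_iff V U).1 hU).1.cond_p.inner_mem u (hu U hU) y
  · intro x w hw
    rw [mem_mcCrimmonRadical_fst]
    rw [mem_mcCrimmonRadical_snd] at hw
    exact fun U hU => ((mem_nondegenerateIdeals_iff V U).1 hU).1.cond_p.outer_mem x w (hw U hU)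
  · intro x y u hu
    rw [mem_mcCrimmonRadical_fst] at *
    exact fun U hU => ((mem_nondegenerateIdeals_iff V U).1 hU).1.cond_p.triple_mem x y u (hu U hU)
  · intro u hu y
    rw [mem_mcCrimmonRadical_snd] at *
    exact fun U hU => ((mem_nondegenerateIdeals_iff V U).1 hU).1.cond_m.inner_mem u (hu U hU) y
  · intro x w hw
    rw [mem_mcCrimmonRadical_snd]
    rw [mem_mcCrimmonRadical_fst] at hw
    exact fun U hU => ((mem_nondegenerateIdeals_iff V U).1 hU).1.cond_m.outer_mem x w (hw U hU)
  · intro x y u hu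
    rw [mem_mcCrimmonRadical_snd] at *
    exact fun U hU => ((mem_nondegenerateIdeals_iff V U).1 hU).1.cond_m.triple_mem x y u (hu U hU)
  · intro x hx
    rw [mem_mcCrimmonRadical_fst]
    intro U hU
    exact ((mem_nondegenerateIdeals_iff V U).1 hU).2.1 x
      fun y => (mem_mcCrimmonRadical_fst V _).1 (hx y) U hU
  · intro x hx
    rw [mem_mcCrimmonRadical_snd]
    intro U hU
    exact ((mem_nondegenerateIdeals_iff V U).1 hU).2.2 x
      fun y => (mem_mcCrimmonRadical_snd V _).1 (hx y) U hU

end JordanPair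

/-! ### Lie algebras: the Kostrikin radical -/

section LieAlgebras

variable (Φ : Type*) {L : Type*} [CommRing Φ] [LieRing L] [LieAlgebra Φ L]

/-- `z` is a crust of a thin sandwich of `L` if `(ad z)² = 0`. -/
def IsThinSandwichCrust (z : L) : Prop :=
  (LieAlgebra.ad Φ L z) ^ 2 = 0

variable (L) in
/-- A Lie algebra is nondegenerate if it has no nonzero crusts of thin sandwiches. -/
def IsNondegenerateLie : Prop :=
  ∀ z : L, IsThinSandwichCrust Φ z → z = 0

variable (L) in
/-- The Kostrikin radical `K(L)`: the smallest ideal of `L` with nondegenerate quotient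
(see `isLeast_kostrikinRadical`). -/
def kostrikinRadical : LieIdeal Φ L :=
  sInf {I : LieIdeal Φ L | IsNondegenerateLie Φ (L ⧸ I)}

theorem isNondegenerateLie_quotient_iff (I : LieIdeal Φ L) :
    IsNondegenerateLie Φ (L ⧸ I) ↔ ∀ z : L, (∀ x : L, ⁅z, ⁅z, x⁆⁆ ∈ I) → z ∈ I := by
  constructor
  · intro h z hz
    refine (LieSubmodule.Quotient.mk_eq_zero I).1 (h (LieSubmodule.Quotient.mk z) ?_)
    refine LinearMap.ext fun a => ?_
    induction a using Submodule.Quotient.induction_on with | _ x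
    exact (LieSubmodule.Quotient.mk_eq_zero I).2 (hz x)
  · intro h a ha
    induction a using Submodule.Quotient.induction_on with | _ z
    refine (LieSubmodule.Quotient.mk_eq_zero I).2 (h z fun x => ?_)
    exact (LieSubmodule.Quotient.mk_eq_zero I).1
      (LinearMap.congr_fun ha (LieSubmodule.Quotient.mk x))

theorem isLeast_kostrikinRadical :
    IsLeast {I : LieIdeal Φ L | IsNondegenerateLie Φ (L ⧸ I)} (kostrikinRadical Φ L) := by
  refine ⟨?_, fun I hI => sInf_le hI⟩
  have hmem : ∀ w : L, w ∈ kostrikinRadical Φ L ↔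
      ∀ I : LieIdeal Φ L, IsNondegenerateLie Φ (L ⧸ I) → w ∈ I := by
    intro w
    rw [← SetLike.mem_coe, kostrikinRadical, LieSubmodule.coe_sInf]
    simp
  refine (isNondegenerateLie_quotient_iff Φ _).2 fun z hz => (hmem z).2 fun I hI => ?_
  exact (isNondegenerateLie_quotient_iff Φ I).1 hI z fun x => (hmem _).1 (hz x) I hI

/-- The canonical projection `L → L / I` as a homomorphism of Lie algebras. -/
def lieQuotientHom (I : LieIdeal Φ L) : L →ₗ⁅Φ⁆ L ⧸ I where
  toLinearMap := I.toSubmodule.mkQ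
  map_lie' := rfl

/-- The preimage `Ĩ = {x ∈ L | [x, L] ⊆ I}` under the canonical projection `L → L / I`
of the center `Z(L / I)`. -/
def centerPreimage (I : LieIdeal Φ L) : LieIdeal Φ L :=
  LieIdeal.comap (lieQuotientHom Φ I) (LieAlgebra.center Φ (L ⧸ I))

theorem mem_centerPreimage (I : LieIdeal Φ L) (x : L) :
    x ∈ centerPreimage Φ I ↔ ∀ y : L, ⁅x, y⁆ ∈ I := by
  rw [centerPreimage, LieIdeal.mem_comap, LieModule.mem_maxTrivSubmodule]
  constructor
  · intro h y
    rw [← lie_skew]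
    exact I.neg_mem ((LieSubmodule.Quotient.mk_eq_zero I).1 (h (LieSubmodule.Quotient.mk y)))
  · intro h a
    induction a using Submodule.Quotient.induction_on with | _ y
    refine (LieSubmodule.Quotient.mk_eq_zero I).2 ?_
    rw [← lie_skew]
    exact I.neg_mem (h y)

end LieAlgebras

/-! ### Jordan 3-graded Lie algebras -/

section JordanThreeGraded

variable {Φ L : Type*} [CommRing Φ] [LieRing L] [LieAlgebra Φ L]

/-- The graded Lie algebra `L = ⨁ ℒ n` is Jordan 3-graded with associated Jordan pair `V`:
the grading is concentrated in the degrees `1, 0, -1`, `[L₁, L₋₁] = L₀`, and `V` is a Jordan pair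
structure on `(L₁, L₋₁)` with `{x, y, z} = [[x, y], z]`. -/
structure IsJordanThreeGraded (ℒ : ℤ → Submodule Φ L) [GradedLieAlgebra ℒ]
    (V : JordanPair Φ (ℒ 1) (ℒ (-1))) : Prop where
  support : ∀ n : ℤ, n ≠ 1 → n ≠ 0 → n ≠ -1 → ℒ n = ⊥
  bracket_eq : Submodule.span Φ {z : L | ∃ x ∈ ℒ 1, ∃ y ∈ ℒ (-1), ⁅x, y⁆ = z} = ℒ 0
  triple_p : ∀ (x z : ℒ 1) (y : ℒ (-1)),
    ((jordanTriple V.Qp x y z : ℒ 1) : L) = ⁅⁅(x : L), (y : L)⁆, (z : L)⁆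
  triple_m : ∀ (x z : ℒ (-1)) (y : ℒ 1),
    ((jordanTriple V.Qm x y z : ℒ (-1)) : L) = ⁅⁅(x : L), (y : L)⁆, (z : L)⁆

/-- The ideal `I(U)` of `L` generated by a pair `U = (U⁺, U⁻)` of submodules of `(L₁, L₋₁)`. -/
def generatedLieIdeal (ℒ : ℤ → Submodule Φ L)
    (U : Submodule Φ (ℒ 1) × Submodule Φ (ℒ (-1))) : LieIdeal Φ L :=
  LieSubmodule.lieSpan Φ L
    (Subtype.val '' (U.1 : Set (ℒ 1)) ∪ Subtype.val '' (U.2 : Set (ℒ (-1))))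

end JordanThreeGraded

/-! Since `{x, y, x} = 2 Q_x y`, having `1/2` turns `Q_x y` into `-(1/2) [x, [x, y]]`, so absolute
zero divisors of `V` and sandwiches of degree `±1` are the same thing, also modulo ideals. Hence
`K(L) ∩ L_{±1}` is an ideal of `V` with nondegenerate quotient
(`idealPair_mem_nondegenerateIdeals`). So `K(L)` contains `Mc(V)` and `I(Mc(V))`, and an element
central modulo `I(Mc(V))` is a sandwich modulo `K(L)`, hence lies in it. For the other inclusion put
`M = Mc(V)` and let `N` consist of the `x` with `x_{±1} ∈ M` and `[x_0, L_{±1}] ⊆ M`. This is an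
ideal with `[N, L] ⊆ I(M)`, and `L / N` is nondegenerate (`isNondegenerateLie_quotient_gradedHull`),
so `K(L) ⊆ N`. The hard point is a sandwich of degree zero (`zero_lie_mem_of_sandwich`). -/

theorem Submodule.mem_of_add_self_mem {Φ V : Type*} [CommRing Φ] (h2 : IsUnit (2 : Φ))
    [AddCommGroup V] [Module Φ V] (U : Submodule Φ V) {x : V} (h : x + x ∈ U) : x ∈ U := by
  rw [← two_smul Φ] at h
  exact (U.smul_mem_iff_of_isUnit h2).1 h

/-! ### Three-graded Lie algebras and their homogeneous components. -/

section GradedComponents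

variable {Φ L : Type*} [CommRing Φ] [LieRing L] [LieAlgebra Φ L]
variable (ℒ : ℤ → Submodule Φ L) [GradedLieAlgebra ℒ]

/-- The projection of a graded Lie algebra onto its component of degree `i`. -/
def gradedComponent (i : ℤ) : L →ₗ[Φ] L :=
  (ℒ i).subtype ∘ₗ DirectSum.component Φ ℤ (fun i => ℒ i) i ∘ₗ
    (DirectSum.decomposeLinearEquiv ℒ).toLinearMap

theorem gradedComponent_mem (i : ℤ) (x : L) : gradedComponent ℒ i x ∈ ℒ i :=
  (DirectSum.decompose ℒ x i).2

theorem gradedComponent_same {i : ℤ} {x : L} (hx : x ∈ ℒ i) : gradedComponent ℒ i x = x :=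
  DirectSum.decompose_of_mem_same ℒ hx

theorem gradedComponent_ne {i j : ℤ} {x : L} (hx : x ∈ ℒ i) (hij : i ≠ j) :
    gradedComponent ℒ j x = 0 :=
  DirectSum.decompose_of_mem_ne ℒ hx hij

theorem lie_mem_graded {i j : ℤ} (k : ℤ) {x y : L} (hx : x ∈ ℒ i) (hy : y ∈ ℒ j)
    (h : i + j = k) : ⁅x, y⁆ ∈ ℒ k :=
  h ▸ SetLike.GradedBracket.bracket_mem hx hy

/-- The Lie algebra is graded in degrees `1, 0, -1` and generated by its components of degree
`1` and `-1`. -/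
structure IsThreeGraded : Prop where
  support : ∀ n : ℤ, n ≠ 1 → n ≠ 0 → n ≠ -1 → ℒ n = ⊥
  bracket_eq : Submodule.span Φ {z : L | ∃ x ∈ ℒ 1, ∃ y ∈ ℒ (-1), ⁅x, y⁆ = z} = ℒ 0

variable {ℒ}

namespace IsThreeGraded

omit [GradedLieAlgebra ℒ] in
/-- Induction on the degree zero component, in a form symmetric in the sign. -/
theorem zero_induction (hL : IsThreeGraded ℒ) {s : ℤ} (hs : s = 1 ∨ s = -1)
    (P : Submodule Φ L) (h : ∀ x ∈ ℒ s, ∀ y ∈ ℒ (-s), ⁅x, y⁆ ∈ P) : ℒ 0 ≤ P := by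
  rw [← hL.bracket_eq, Submodule.span_le]
  rintro _ ⟨x, hx, y, hy, rfl⟩
  rcases hs with rfl | rfl
  · exact h x hx y hy
  · rw [SetLike.mem_coe, ← lie_skew]
    exact P.neg_mem (h y hy x (by simpa using hx))

theorem lie_eq_zero (hL : IsThreeGraded ℒ) {s : ℤ} (hs : s = 1 ∨ s = -1) {x y : L}
    (hx : x ∈ ℒ s) (hy : y ∈ ℒ s) : ⁅x, y⁆ = 0 := by
  have h : ⁅x, y⁆ ∈ ℒ (s + s) := lie_mem_graded ℒ _ hx hy rfl
  rw [hL.support (s + s) (by omega) (by omega) (by omega)] at h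
  exact (Submodule.mem_bot Φ).1 h

theorem eq_sum_components (hL : IsThreeGraded ℒ) (x : L) :
    x = gradedComponent ℒ 1 x + gradedComponent ℒ 0 x + gradedComponent ℒ (-1) x := by
  classical
  induction x using DirectSum.Decomposition.inductionOn ℒ with
  | zero => simp
  | @homogeneous i m =>
    by_cases h1 : i = 1
    · subst h1
      rw [gradedComponent_same ℒ m.2, gradedComponent_ne ℒ m.2 (by decide),
        gradedComponent_ne ℒ m.2 (by decide)]
      simp
    by_cases h0 : i = 0
    · subst h0
      rw [gradedComponent_same ℒ m.2, gradedComponent_ne ℒ m.2 (by decide),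
        gradedComponent_ne ℒ m.2 (by decide)]
      simp
    by_cases hm : i = -1
    · subst hm
      rw [gradedComponent_same ℒ m.2, gradedComponent_ne ℒ m.2 (by decide),
        gradedComponent_ne ℒ m.2 (by decide)]
      simp
    · have h : (m : L) = 0 := (Submodule.mem_bot Φ).1 ((hL.support i h1 h0 hm).le m.2)
      simp [h]
  | add a b ha hb =>
    simp only [map_add]
    nth_rewrite 1 [ha, hb]
    abel

end IsThreeGraded

variable (ℒ) in
/-- The submodules `M 1 ⊆ L₁` and `M (-1) ⊆ L₋₁` form an ideal of the pair `(L₁, L₋₁)` with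
triple products `[[x, y], z]`, and the quotient is nondegenerate. -/
structure IsNondegeneratePairIdeal (M : ℤ → Submodule Φ L) : Prop where
  le : ∀ s : ℤ, s = 1 ∨ s = -1 → M s ≤ ℒ s
  triple_mem : ∀ s : ℤ, s = 1 ∨ s = -1 → ∀ a ∈ M s, ∀ y ∈ ℒ (-s), ∀ v ∈ ℒ s, ⁅⁅a, y⁆, v⁆ ∈ M s
  outer_mem : ∀ s : ℤ, s = 1 ∨ s = -1 → ∀ a ∈ M s, ∀ y ∈ ℒ (-s), ∀ w ∈ ℒ (-s),
    ⁅⁅a, y⁆, w⁆ ∈ M (-s)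
  nondegenerate : ∀ s : ℤ, s = 1 ∨ s = -1 → ∀ x ∈ ℒ s,
    (∀ y ∈ ℒ (-s), ⁅x, ⁅x, y⁆⁆ ∈ M s) → x ∈ M s

/-! ### The graded hull `N` of a nondegenerate pair ideal `M`. -/

namespace IsNondegeneratePairIdeal

variable {M : ℤ → Submodule Φ L}

/-- As `L_0` is spanned by brackets `[p, q]`, this is the symmetry `[[p, q], a] = [[a, q], p]` of
the triple product, which follows from `[p, a] = 0`. -/
theorem zero_lie_mem (hL : IsThreeGraded ℒ) (hM : IsNondegeneratePairIdeal ℒ M) {s : ℤ}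
    (hs : s = 1 ∨ s = -1) {a y : L} (ha : a ∈ M s) (hy : y ∈ ℒ 0) : ⁅y, a⁆ ∈ M s := by
  refine hL.zero_induction hs
    ((M s).comap ((LieModule.toEnd Φ L L : L →ₗ[Φ] Module.End Φ L).flip a)) (fun p hp q hq => ?_) hy
  change ⁅⁅p, q⁆, a⁆ ∈ M s
  have h : ⁅⁅p, q⁆, a⁆ = ⁅⁅a, q⁆, p⁆ := by
    rw [lie_lie p q a, hL.lie_eq_zero hs hp (hM.le s hs ha), lie_zero, sub_zero,
      ← lie_skew ⁅a, q⁆ p, ← lie_skew a q, lie_neg, neg_neg]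
  rw [h]
  exact hM.triple_mem s hs a ha q hq p hp

variable (ℒ M) in
/-- The elements `x` with `x₁ ∈ M 1`, `x₋₁ ∈ M (-1)` and `[x₀, L_σ] ⊆ M σ` for `σ = ±1`. -/
def gradedHullSubmodule : Submodule Φ L where
  carrier := {x | ∀ s : ℤ, s = 1 ∨ s = -1 → gradedComponent ℒ s x ∈ M s ∧
    ∀ v ∈ ℒ s, ⁅gradedComponent ℒ 0 x, v⁆ ∈ M s}
  zero_mem' := fun s _ => by simp
  add_mem' := fun {a b} ha hb s hs => by
    refine ⟨?_, fun v hv => ?_⟩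
    · rw [map_add]; exact (M s).add_mem (ha s hs).1 (hb s hs).1
    · rw [map_add, add_lie]; exact (M s).add_mem ((ha s hs).2 v hv) ((hb s hs).2 v hv)
  smul_mem' := fun c a ha s hs => by
    refine ⟨?_, fun v hv => ?_⟩
    · rw [map_smul]; exact (M s).smul_mem c (ha s hs).1
    · rw [map_smul, smul_lie]; exact (M s).smul_mem c ((ha s hs).2 v hv)

theorem mem_hull_of_mem (hM : IsNondegeneratePairIdeal ℒ M) {s : ℤ} (hs : s = 1 ∨ s = -1)
    {a : L} (ha : a ∈ M s) : a ∈ gradedHullSubmodule ℒ M := by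
  intro t ht
  have ha' := hM.le s hs ha
  refine ⟨?_, fun v _ => ?_⟩
  · by_cases h : s = t
    · subst h; rwa [gradedComponent_same ℒ ha']
    · rw [gradedComponent_ne ℒ ha' h]; exact zero_mem _
  · rw [gradedComponent_ne ℒ ha' (by omega), zero_lie]; exact zero_mem _

theorem mem_hull_zero {x : L} (hx : x ∈ ℒ 0)
    (h : ∀ s : ℤ, s = 1 ∨ s = -1 → ∀ v ∈ ℒ s, ⁅x, v⁆ ∈ M s) : x ∈ gradedHullSubmodule ℒ M := by
  intro s hs
  rw [gradedComponent_same ℒ hx, gradedComponent_ne ℒ hx (by omega)]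
  exact ⟨zero_mem _, h s hs⟩

/-- Bracketing `a` with `L_0` stays in `M s` and with `L_s` gives zero. With `L_{-s}` it lands in
degree zero, where `triple_mem` and `outer_mem` are exactly the hull condition. -/
theorem lie_mem_hull_of_mem (hL : IsThreeGraded ℒ) (hM : IsNondegeneratePairIdeal ℒ M) {s : ℤ}
    (hs : s = 1 ∨ s = -1) {a : L} (ha : a ∈ M s) (y : L) :
    ⁅a, y⁆ ∈ gradedHullSubmodule ℒ M := by
  have hzero : ∀ z ∈ ℒ 0, ⁅a, z⁆ ∈ gradedHullSubmodule ℒ M := fun z hz => by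
    rw [← lie_skew]
    exact neg_mem (hM.mem_hull_of_mem hs (hM.zero_lie_mem hL hs ha hz))
  have hsame : ∀ z ∈ ℒ s, ⁅a, z⁆ ∈ gradedHullSubmodule ℒ M := fun z hz => by
    rw [hL.lie_eq_zero hs (hM.le s hs ha) hz]; exact zero_mem _
  have hopp : ∀ z ∈ ℒ (-s), ⁅a, z⁆ ∈ gradedHullSubmodule ℒ M := fun z hz => by
    refine mem_hull_zero (lie_mem_graded ℒ 0 (hM.le s hs ha) hz (by omega)) fun t ht v hv => ?_
    obtain rfl | rfl : t = s ∨ t = -s := by omega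
    · exact hM.triple_mem t hs a ha z hz v hv
    · exact hM.outer_mem s hs a ha z hz v hv
  rw [hL.eq_sum_components y, lie_add, lie_add]
  refine add_mem (add_mem ?_ (hzero _ (gradedComponent_mem ℒ _ _))) ?_
  · obtain rfl | rfl := hs
    · exact hsame _ (gradedComponent_mem ℒ _ _)
    · exact hopp _ (gradedComponent_mem ℒ _ _)
  · obtain rfl | rfl := hs
    · exact hopp _ (gradedComponent_mem ℒ _ _)
    · exact hsame _ (gradedComponent_mem ℒ _ _)

theorem zero_lie_mem_hull (hL : IsThreeGraded ℒ) (hM : IsNondegeneratePairIdeal ℒ M) {x : L}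
    (hx : x ∈ ℒ 0) (h : ∀ s : ℤ, s = 1 ∨ s = -1 → ∀ v ∈ ℒ s, ⁅x, v⁆ ∈ M s) (y : L) :
    ⁅x, y⁆ ∈ gradedHullSubmodule ℒ M := by
  rw [hL.eq_sum_components y, lie_add, lie_add]
  refine add_mem (add_mem ?_ ?_) ?_
  · exact hM.mem_hull_of_mem (.inl rfl) (h 1 (.inl rfl) _ (gradedComponent_mem ℒ _ _))
  · have hy := gradedComponent_mem ℒ 0 y
    refine mem_hull_zero (lie_mem_graded ℒ 0 hx hy rfl) fun s hs v hv => ?_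
    -- `[[x, y], v] = [x, [y, v]] - [y, [x, v]]`, and both terms lie in `M s`.
    rw [lie_lie]
    exact sub_mem (h s hs _ (lie_mem_graded ℒ s hy hv (zero_add s)))
      (hM.zero_lie_mem hL hs (h s hs v hv) hy)
  · exact hM.mem_hull_of_mem (.inr rfl) (h (-1) (.inr rfl) _ (gradedComponent_mem ℒ _ _))

/-- `gradedHullSubmodule` as an ideal of the Lie algebra. -/
def gradedHull (hL : IsThreeGraded ℒ) (hM : IsNondegeneratePairIdeal ℒ M) : LieIdeal Φ L where
  toSubmodule := gradedHullSubmodule ℒ M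
  lie_mem := fun {y x} hx => by
    change ⁅y, x⁆ ∈ gradedHullSubmodule ℒ M
    rw [← lie_skew, hL.eq_sum_components x, add_lie, add_lie]
    exact neg_mem (add_mem (add_mem (hM.lie_mem_hull_of_mem hL (.inl rfl) (hx 1 (.inl rfl)).1 y)
      (hM.zero_lie_mem_hull hL (gradedComponent_mem ℒ _ _) (fun s hs => (hx s hs).2) y))
      (hM.lie_mem_hull_of_mem hL (.inr rfl) (hx (-1) (.inr rfl)).1 y))

theorem mem_gradedHull (hL : IsThreeGraded ℒ) (hM : IsNondegeneratePairIdeal ℒ M) (x : L) :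
    x ∈ gradedHull hL hM ↔ ∀ s : ℤ, s = 1 ∨ s = -1 → gradedComponent ℒ s x ∈ M s ∧
      ∀ v ∈ ℒ s, ⁅gradedComponent ℒ 0 x, v⁆ ∈ M s := Iff.rfl

/-- With `mem_hull_of_mem` this gives `N ∩ L_s = M s`, so computations can be made modulo the ideal
`N`. -/
theorem mem_of_mem_gradedHull (hL : IsThreeGraded ℒ) (hM : IsNondegeneratePairIdeal ℒ M) {s : ℤ}
    (hs : s = 1 ∨ s = -1) {x : L} (hx : x ∈ ℒ s) (h : x ∈ gradedHull hL hM) : x ∈ M s := by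
  simpa [gradedComponent_same ℒ hx] using (h s hs).1

/-- If `2` is invertible, the components of degree `±1` of a sandwich modulo the hull
lie in the pair ideal. -/
theorem component_mem_of_sandwich (hL : IsThreeGraded ℒ) (hM : IsNondegeneratePairIdeal ℒ M)
    {z : L} (hz : ∀ x : L, ⁅z, ⁅z, x⁆⁆ ∈ gradedHull hL hM) {s : ℤ} (hs : s = 1 ∨ s = -1) :
    gradedComponent ℒ s z ∈ M s := by
  refine hM.nondegenerate s hs _ (gradedComponent_mem ℒ _ _) fun y hy => ?_
  have h := (hz y s hs).1
  obtain ⟨p, q, hp, hq, hzpq⟩ : ∃ p q : L, p ∈ ℒ 0 ∧ q ∈ ℒ (-s) ∧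
      z = gradedComponent ℒ s z + p + q := by
    refine ⟨gradedComponent ℒ 0 z, gradedComponent ℒ (-s) z, gradedComponent_mem ℒ _ _,
      gradedComponent_mem ℒ _ _, ?_⟩
    obtain rfl | rfl := hs
    · exact hL.eq_sum_components z
    · nth_rewrite 1 [hL.eq_sum_components z]
      rw [neg_neg]
      abel
  have ha : gradedComponent ℒ s z ∈ ℒ s := gradedComponent_mem ℒ _ _
  generalize gradedComponent ℒ s z = a at *
  have hs' : -s = 1 ∨ -s = -1 := by omega
  have hay : ⁅a, y⁆ ∈ ℒ 0 := lie_mem_graded ℒ 0 ha hy (by omega)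
  have hpy : ⁅p, y⁆ ∈ ℒ (-s) := lie_mem_graded ℒ (-s) hp hy (by omega)
  -- The terms are grouped by degree `s`, `0`, `-s`; the brackets `[q, y]` and `[q, [p, y]]` vanish
  -- in degree `-2s`. Only `[a, [a, y]]` survives in degree `s`.
  have hexp : ⁅z, ⁅z, y⁆⁆ = ⁅a, ⁅a, y⁆⁆ + (⁅a, ⁅p, y⁆⁆ + ⁅p, ⁅a, y⁆⁆) + (⁅p, ⁅p, y⁆⁆ + ⁅q, ⁅a, y⁆⁆) := by
    rw [hzpq]
    simp only [add_lie, lie_add, hL.lie_eq_zero hs' hq hy, hL.lie_eq_zero hs' hq hpy, lie_zero]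
    abel
  have h0 : ⁅a, ⁅p, y⁆⁆ + ⁅p, ⁅a, y⁆⁆ ∈ ℒ 0 := add_mem
    (lie_mem_graded ℒ 0 ha hpy (by omega)) (lie_mem_graded ℒ 0 hp hay (by omega))
  have hneg : ⁅p, ⁅p, y⁆⁆ + ⁅q, ⁅a, y⁆⁆ ∈ ℒ (-s) := add_mem
    (lie_mem_graded ℒ (-s) hp hpy (by omega)) (lie_mem_graded ℒ (-s) hq hay (by omega))
  rw [hexp, map_add, map_add, gradedComponent_same ℒ (lie_mem_graded ℒ s ha hay (by omega)),
    gradedComponent_ne ℒ h0 (by omega), gradedComponent_ne ℒ hneg (by omega)] at h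
  simpa using h

/-- A sandwich of degree zero modulo the hull maps `L_σ` into `M σ`. -/
theorem zero_lie_mem_of_sandwich (h2 : IsUnit (2 : Φ)) (hL : IsThreeGraded ℒ)
    (hM : IsNondegeneratePairIdeal ℒ M) {d : L} (hd : d ∈ ℒ 0)
    (hdd : ∀ x : L, ⁅d, ⁅d, x⁆⁆ ∈ gradedHull hL hM) {s : ℤ} (hs : s = 1 ∨ s = -1) {x : L}
    (hx : x ∈ ℒ s) : ⁅d, x⁆ ∈ M s := by
  have hdx : ⁅d, x⁆ ∈ ℒ s := lie_mem_graded ℒ s hd hx (zero_add s)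
  refine hM.nondegenerate s hs _ hdx fun y hy => ?_
  have hmem : ⁅⁅d, x⁆, ⁅⁅d, x⁆, y⁆⁆ ∈ ℒ s :=
    lie_mem_graded ℒ s hdx (lie_mem_graded ℒ 0 hdx hy (by omega)) (by omega)
  refine hM.mem_of_mem_gradedHull hL hs hmem ?_
  set N := gradedHull hL hM
  have hxx := hdd x
  have hyy := hdd y
  have hex : ⁅⁅d, x⁆, x⁆ = 0 := hL.lie_eq_zero hs hdx hx
  -- With `D = ad d`, expand `D²[x, y]` and `D²[x, [x, y]]` by the Leibniz rule; below `e = Dx`, `f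
  -- = Dy`, and `u = D²x`, `w = D²y` are in `N`.
  have hxy := hdd ⁅x, y⁆
  have hxxy := hdd ⁅x, ⁅x, y⁆⁆
  simp only [leibniz_lie d x, leibniz_lie d ⁅d, x⁆, lie_add] at hxy hxxy
  generalize ⁅d, ⁅d, x⁆⁆ = u at *
  generalize ⁅d, ⁅d, y⁆⁆ = w at *
  generalize ⁅d, x⁆ = e at *
  generalize ⁅d, y⁆ = f at *
  -- `D²[x, y] = [u, y] + 2[e, f] + [x, w]`.
  have hef : ⁅e, f⁆ ∈ N := by
    refine N.toSubmodule.mem_of_add_self_mem h2 ((LieSubmodule.mem_toSubmodule N).2 ?_)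
    have h := sub_mem (sub_mem hxy (lie_mem_left Φ L N u y hxx)) (N.lie_mem (x := x) hyy)
    convert h using 1
    abel
  have hxef : ⁅x, ⁅e, f⁆⁆ ∈ N := N.lie_mem hef
  -- Since `[e, x] = 0`, this equals `[x, [e, f]]`. All terms of `D²[x, [x, y]]` except `2[e, [e,
  -- y]]` are then in `N`.
  have hexf : ⁅e, ⁅x, f⁆⁆ ∈ N := by rwa [leibniz_lie, hex, zero_lie, zero_add]
  refine N.toSubmodule.mem_of_add_self_mem h2 ((LieSubmodule.mem_toSubmodule N).2 ?_)
  have h1 : ⁅u, ⁅x, y⁆⁆ ∈ N := lie_mem_left Φ L N _ _ hxx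
  have h3 : ⁅x, ⁅u, y⁆⁆ ∈ N := N.lie_mem (lie_mem_left Φ L N _ _ hxx)
  have h4 : ⁅x, ⁅x, w⁆⁆ ∈ N := N.lie_mem (N.lie_mem hyy)
  have h := sub_mem (sub_mem (sub_mem hxxy h1) h3) h4
  have h' := sub_mem h (add_mem (add_mem hexf hexf) (add_mem hxef hxef))
  convert h' using 1
  abel

/-- The components of degree `±1` of a sandwich `z` modulo `N` are already in `N`, so `z_0` is again
a sandwich modulo `N` and the degree zero case applies. -/
theorem isNondegenerateLie_quotient_gradedHull (h2 : IsUnit (2 : Φ)) (hL : IsThreeGraded ℒ)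
    (hM : IsNondegeneratePairIdeal ℒ M) : IsNondegenerateLie Φ (L ⧸ gradedHull hL hM) := by
  rw [isNondegenerateLie_quotient_iff]
  intro z hz
  set N := gradedHull hL hM
  have hp : gradedComponent ℒ 1 z ∈ N :=
    hM.mem_hull_of_mem (.inl rfl) (hM.component_mem_of_sandwich hL hz (.inl rfl))
  have hm : gradedComponent ℒ (-1) z ∈ N :=
    hM.mem_hull_of_mem (.inr rfl) (hM.component_mem_of_sandwich hL hz (.inr rfl))
  have hzd : z - gradedComponent ℒ 0 z ∈ N := by
    have : z - gradedComponent ℒ 0 z = gradedComponent ℒ 1 z + gradedComponent ℒ (-1) z := by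
      nth_rewrite 1 [hL.eq_sum_components z]; abel
    rw [this]; exact add_mem hp hm
  -- Replacing `z` by `z_0` changes `(ad z)²` only by terms with a factor `z - z_0 ∈ N`.
  have hd : ∀ x : L, ⁅gradedComponent ℒ 0 z, ⁅gradedComponent ℒ 0 z, x⁆⁆ ∈ N := fun x => by
    have h1 : ⁅z, ⁅z - gradedComponent ℒ 0 z, x⁆⁆ ∈ N := N.lie_mem (lie_mem_left Φ L N _ _ hzd)
    have h3 : ⁅z - gradedComponent ℒ 0 z, ⁅gradedComponent ℒ 0 z, x⁆⁆ ∈ N :=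
      lie_mem_left Φ L N _ _ hzd
    have h4 := sub_mem (sub_mem (hz x) h1) h3
    simp only [sub_lie, lie_sub] at h4
    convert h4 using 1
    abel
  have h0 : gradedComponent ℒ 0 z ∈ N := mem_hull_zero (gradedComponent_mem ℒ _ _)
    fun s hs v hv => hM.zero_lie_mem_of_sandwich h2 hL (gradedComponent_mem ℒ _ _) hd hs hv
  simpa using add_mem hzd h0

/-- Only `[x_0, L_0]` is not immediate: `[x_0, [p, q]] = [[x_0, p], q] + [p, [x_0, q]]`, where both
inner brackets lie in `M`. -/
theorem gradedHull_le_centerPreimage (hL : IsThreeGraded ℒ) (hM : IsNondegeneratePairIdeal ℒ M)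
    (J : LieIdeal Φ L) (hJ : ∀ s : ℤ, s = 1 ∨ s = -1 → ∀ a ∈ M s, a ∈ J) :
    gradedHull hL hM ≤ centerPreimage Φ J := by
  intro x hx
  rw [mem_centerPreimage]
  intro y
  have hp := hx 1 (.inl rfl)
  have hm := hx (-1) (.inr rfl)
  have h0 : ∀ v ∈ ℒ 0, ⁅gradedComponent ℒ 0 x, v⁆ ∈ J := by
    refine hL.zero_induction (.inl rfl)
      (J.toSubmodule.comap (LieAlgebra.ad Φ L (gradedComponent ℒ 0 x))) fun p hp' q hq => ?_
    change ⁅gradedComponent ℒ 0 x, ⁅p, q⁆⁆ ∈ J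
    rw [leibniz_lie]
    exact add_mem (lie_mem_left Φ L J _ _ (hJ 1 (.inl rfl) _ (hp.2 p hp')))
      (J.lie_mem (hJ (-1) (.inr rfl) _ (hm.2 q hq)))
  rw [hL.eq_sum_components x, add_lie, add_lie]
  refine add_mem (add_mem (lie_mem_left Φ L J _ _ (hJ 1 (.inl rfl) _ hp.1)) ?_)
    (lie_mem_left Φ L J _ _ (hJ (-1) (.inr rfl) _ hm.1))
  rw [hL.eq_sum_components y, lie_add, lie_add]
  exact add_mem (add_mem (hJ 1 (.inl rfl) _ (hp.2 _ (gradedComponent_mem ℒ _ _)))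
    (h0 _ (gradedComponent_mem ℒ _ _)))
    (hJ (-1) (.inr rfl) _ (hm.2 _ (gradedComponent_mem ℒ _ _)))

end IsNondegeneratePairIdeal

end GradedComponents

/-! ### Central elements modulo an ideal are sandwiches. -/

section Radicals

variable {Φ L : Type*} [CommRing Φ] [LieRing L] [LieAlgebra Φ L]

theorem centerPreimage_le_of_nondegenerate (I J : LieIdeal Φ L)
    (hI : IsNondegenerateLie Φ (L ⧸ I)) (hJ : J ≤ I) : centerPreimage Φ J ≤ I := by
  intro x hx
  rw [mem_centerPreimage] at hx
  exact (isNondegenerateLie_quotient_iff Φ I).1 hI x fun y => I.lie_mem (hJ (hx y))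

end Radicals

/-! ### Passage between Jordan pair ideals and Lie ideals. -/

namespace IsJordanThreeGraded

variable {Φ L : Type*} [CommRing Φ] [LieRing L] [LieAlgebra Φ L]
variable {ℒ : ℤ → Submodule Φ L} [GradedLieAlgebra ℒ] {V : JordanPair Φ (ℒ 1) (ℒ (-1))}

theorem isThreeGraded (hL : IsJordanThreeGraded ℒ V) : IsThreeGraded ℒ :=
  ⟨hL.support, hL.bracket_eq⟩

/-- `{x, y, x} = Q_{2x} y - 2 Q_x y = (4 - 2) Q_x y`. -/
theorem two_Qp (hL : IsJordanThreeGraded ℒ V) (x : ℒ 1) (y : ℒ (-1)) :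
    ((V.Qp x y + V.Qp x y : ℒ 1) : L) = -⁅(x : L), ⁅(x : L), (y : L)⁆⁆ := by
  rw [lie_skew, ← hL.triple_p, jordanTriple, ← two_smul Φ x, QuadraticMap.map_smul]
  congr 1
  rw [LinearMap.smul_apply, show (2 * 2 : Φ) = 1 + 1 + 1 + 1 by norm_num]
  simp only [add_smul, one_smul]
  abel

theorem two_Qm (hL : IsJordanThreeGraded ℒ V) (x : ℒ (-1)) (y : ℒ 1) :
    ((V.Qm x y + V.Qm x y : ℒ (-1)) : L) = -⁅(x : L), ⁅(x : L), (y : L)⁆⁆ := by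
  rw [lie_skew, ← hL.triple_m, jordanTriple, ← two_smul Φ x, QuadraticMap.map_smul]
  congr 1
  rw [LinearMap.smul_apply, show (2 * 2 : Φ) = 1 + 1 + 1 + 1 by norm_num]
  simp only [add_smul, one_smul]
  abel

/-- A pair of submodules of `(L₁, L₋₁)` as a family of submodules of `L`. -/
def pairSubmodule (U : Submodule Φ (ℒ 1) × Submodule Φ (ℒ (-1))) (s : ℤ) : Submodule Φ L :=
  if s = 1 then U.1.map (ℒ 1).subtype else U.2.map (ℒ (-1)).subtype

theorem isNondegeneratePairIdeal (h2 : IsUnit (2 : Φ)) (hL : IsJordanThreeGraded ℒ V)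
    {U : Submodule Φ (ℒ 1) × Submodule Φ (ℒ (-1))} (hU : U ∈ V.nondegenerateIdeals) :
    IsNondegeneratePairIdeal ℒ (pairSubmodule U) := by
  rw [JordanPair.mem_nondegenerateIdeals_iff] at hU
  obtain ⟨⟨hp, hm⟩, hnp, hnm⟩ := hU
  have comm_p (x z : ℒ 1) (y : ℒ (-1)) : jordanTriple V.Qp x y z = jordanTriple V.Qp z y x := by
    rw [jordanTriple, jordanTriple, add_comm x z]; abel
  have comm_m (x z : ℒ (-1)) (y : ℒ 1) : jordanTriple V.Qm x y z = jordanTriple V.Qm z y x := by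
    rw [jordanTriple, jordanTriple, add_comm x z]; abel
  refine ⟨?_, ?_, ?_, ?_⟩
  · rintro s (rfl | rfl) _ ⟨a, -, rfl⟩ <;> exact a.2
  · rintro s (rfl | rfl) _ ⟨a, ha, rfl⟩ y hy v hv
    · refine ⟨jordanTriple V.Qp a ⟨y, hy⟩ ⟨v, hv⟩, ?_, hL.triple_p a ⟨v, hv⟩ ⟨y, hy⟩⟩
      rw [comm_p]
      exact hp.triple_mem _ _ a ha
    · rw [neg_neg] at hy
      refine ⟨jordanTriple V.Qm a ⟨y, hy⟩ ⟨v, hv⟩, ?_, hL.triple_m a ⟨v, hv⟩ ⟨y, hy⟩⟩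
      rw [comm_m]
      exact hm.triple_mem _ _ a ha
  · rintro s (rfl | rfl) _ ⟨a, ha, rfl⟩ y hy w hw
    · rw [← lie_skew _ y, neg_lie]
      refine neg_mem ⟨jordanTriple V.Qm ⟨y, hy⟩ a ⟨w, hw⟩, ?_,
        hL.triple_m ⟨y, hy⟩ ⟨w, hw⟩ a⟩
      -- `{y, a, w}` is by definition a combination of three values `Q_v a`.
      exact sub_mem (sub_mem (hm.outer_mem _ a ha) (hm.outer_mem _ a ha)) (hm.outer_mem _ a ha)
    · rw [neg_neg] at *
      rw [← lie_skew _ y, neg_lie]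
      refine neg_mem ⟨jordanTriple V.Qp ⟨y, hy⟩ a ⟨w, hw⟩, ?_,
        hL.triple_p ⟨y, hy⟩ ⟨w, hw⟩ a⟩
      exact sub_mem (sub_mem (hp.outer_mem _ a ha) (hp.outer_mem _ a ha)) (hp.outer_mem _ a ha)
  · rintro s (rfl | rfl) x hx h
    · refine ⟨⟨x, hx⟩, hnp _ fun y => U.1.mem_of_add_self_mem h2 ?_, rfl⟩
      obtain ⟨a, ha, hax⟩ := h y y.2
      have : V.Qp ⟨x, hx⟩ y + V.Qp ⟨x, hx⟩ y = -a := Subtype.ext <| by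
        rw [hL.two_Qp, ← hax]; rfl
      rw [this]
      exact neg_mem ha
    · refine ⟨⟨x, hx⟩, hnm _ fun y => U.2.mem_of_add_self_mem h2 ?_, rfl⟩
      obtain ⟨a, ha, hax⟩ := h y (by simp)
      have : V.Qm ⟨x, hx⟩ y + V.Qm ⟨x, hx⟩ y = -a := Subtype.ext <| by
        rw [hL.two_Qm, ← hax]; rfl
      rw [this]
      exact neg_mem ha

/-- The pair of components of degree `±1` of an ideal of the Lie algebra. -/
def idealPair (ℒ : ℤ → Submodule Φ L) (I : LieIdeal Φ L) :
    Submodule Φ (ℒ 1) × Submodule Φ (ℒ (-1)) :=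
  (I.toSubmodule.comap (ℒ 1).subtype, I.toSubmodule.comap (ℒ (-1)).subtype)

theorem idealPair_mem_nondegenerateIdeals (h2 : IsUnit (2 : Φ)) (hL : IsJordanThreeGraded ℒ V)
    (I : LieIdeal Φ L) (hI : IsNondegenerateLie Φ (L ⧸ I)) :
    idealPair ℒ I ∈ V.nondegenerateIdeals := by
  rw [isNondegenerateLie_quotient_iff] at hI
  rw [JordanPair.mem_nondegenerateIdeals_iff]
  -- For `x` of degree `s`, `(ad x)²` kills `L_0` and `L_s` by degree, so the sandwich condition
  -- need only be tested on `L_{-s}`.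
  have key {s : ℤ} (hs : s = 1 ∨ s = -1) {x : L} (hx : x ∈ ℒ s)
      (h : ∀ y ∈ ℒ (-s), ⁅x, ⁅x, y⁆⁆ ∈ I) : x ∈ I := by
    have hzero : ∀ y ∈ ℒ 0, ⁅x, ⁅x, y⁆⁆ ∈ I := fun y hy => by
      rw [hL.isThreeGraded.lie_eq_zero hs hx (lie_mem_graded ℒ s hx hy (add_zero s))]
      exact zero_mem I
    have hsame : ∀ y ∈ ℒ s, ⁅x, ⁅x, y⁆⁆ ∈ I := fun y hy => by
      rw [hL.isThreeGraded.lie_eq_zero hs hx hy, lie_zero]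
      exact zero_mem I
    refine hI x fun y => ?_
    rw [hL.isThreeGraded.eq_sum_components y]
    simp only [lie_add]
    refine add_mem (add_mem ?_ (hzero _ (gradedComponent_mem ℒ _ _))) ?_
    · obtain rfl | rfl := hs
      · exact hsame _ (gradedComponent_mem ℒ _ _)
      · exact h _ (gradedComponent_mem ℒ _ _)
    · obtain rfl | rfl := hs
      · exact h _ (gradedComponent_mem ℒ _ _)
      · exact hsame _ (gradedComponent_mem ℒ _ _)
  refine ⟨⟨⟨?_, ?_, ?_⟩, ⟨?_, ?_, ?_⟩⟩, ?_, ?_⟩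
  · intro u hu y
    refine Submodule.mem_of_add_self_mem h2 _ ?_
    change ((V.Qp u y + V.Qp u y : ℒ 1) : L) ∈ I
    rw [hL.two_Qp]
    exact neg_mem (I.lie_mem (lie_mem_left Φ L I _ _ hu))
  · intro u w hw
    refine Submodule.mem_of_add_self_mem h2 _ ?_
    change ((V.Qp u w + V.Qp u w : ℒ 1) : L) ∈ I
    rw [hL.two_Qp]
    exact neg_mem (I.lie_mem (I.lie_mem hw))
  · intro x y u hu
    change ((jordanTriple V.Qp x y u : ℒ 1) : L) ∈ I
    rw [hL.triple_p]
    exact I.lie_mem hu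
  · intro u hu y
    refine Submodule.mem_of_add_self_mem h2 _ ?_
    change ((V.Qm u y + V.Qm u y : ℒ (-1)) : L) ∈ I
    rw [hL.two_Qm]
    exact neg_mem (I.lie_mem (lie_mem_left Φ L I _ _ hu))
  · intro u w hw
    refine Submodule.mem_of_add_self_mem h2 _ ?_
    change ((V.Qm u w + V.Qm u w : ℒ (-1)) : L) ∈ I
    rw [hL.two_Qm]
    exact neg_mem (I.lie_mem (I.lie_mem hw))
  · intro x y u hu
    change ((jordanTriple V.Qm x y u : ℒ (-1)) : L) ∈ I
    rw [hL.triple_m]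
    exact I.lie_mem hu
  · intro x hx
    refine key (.inl rfl) x.2 fun y hy => ?_
    change ⁅(x : L), ⁅(x : L), y⁆⁆ ∈ I
    rw [← neg_neg ⁅(x : L), ⁅(x : L), y⁆⁆, ← hL.two_Qp x ⟨y, hy⟩]
    exact neg_mem (add_mem (hx ⟨y, hy⟩) (hx ⟨y, hy⟩))
  · intro x hx
    refine key (.inr rfl) x.2 fun y hy => ?_
    rw [neg_neg] at hy
    change ⁅(x : L), ⁅(x : L), y⁆⁆ ∈ I
    rw [← neg_neg ⁅(x : L), ⁅(x : L), y⁆⁆, ← hL.two_Qm x ⟨y, hy⟩]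
    exact neg_mem (add_mem (hx ⟨y, hy⟩) (hx ⟨y, hy⟩))

end IsJordanThreeGraded

/-! ### The two inclusions combined. -/

theorem mainTheorem7 {Φ L : Type*} [CommRing Φ] (h2 : IsUnit (2 : Φ)) [LieRing L] [LieAlgebra Φ L]
    (ℒ : ℤ → Submodule Φ L) [GradedLieAlgebra ℒ] (V : JordanPair Φ (ℒ 1) (ℒ (-1)))
    (hL : IsJordanThreeGraded ℒ V) :
    kostrikinRadical Φ L = centerPreimage Φ (generatedLieIdeal ℒ V.mcCrimmonRadical) := by
  have hM := hL.isNondegeneratePairIdeal h2 V.isLeast_mcCrimmonRadical.1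
  have hK := (isLeast_kostrikinRadical (L := L) Φ).1
  -- Minimality of `Mc(V)` gives `Mc(V) ⊆ K(L) ∩ L_{±1}`.
  have hmc := V.isLeast_mcCrimmonRadical.2 (hL.idealPair_mem_nondegenerateIdeals h2 _ hK)
  refine le_antisymm ?_ (centerPreimage_le_of_nondegenerate _ _ hK ?_)
  · refine ((isLeast_kostrikinRadical (L := L) Φ).2
      (hM.isNondegenerateLie_quotient_gradedHull h2 hL.isThreeGraded)).trans
      (hM.gradedHull_le_centerPreimage hL.isThreeGraded _ ?_)
    rintro s (rfl | rfl) _ ⟨a, ha, rfl⟩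
    · exact LieSubmodule.subset_lieSpan (.inl ⟨a, ha, rfl⟩)
    · exact LieSubmodule.subset_lieSpan (.inr ⟨a, ha, rfl⟩)
  · refine LieSubmodule.lieSpan_le.2 ?_
    rintro _ (⟨a, ha, rfl⟩ | ⟨a, ha, rfl⟩)
    · exact hmc.1 ha
    · exact hmc.2 ha
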